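/- Let $C^*(F_\infty)$ be the full group $C^*$-algebra of the free group $F_\infty$ on countably infinitely many generators, and let $\mathcal B$ be a nuclear (not necessarily unital) $C^*$-algebra, i.e. for every $C^*$-algebra $\mathcal A$ the algebraic tensor product $\mathcal A\odot\mathcal B$ carries exactly one $C^*$-norm. Let $\rho_1$ be a state on $B(\ell^2)$, let $\rho_2$ be a state on $\mathcal B$, and let $\rho_1\otimes\rho_2$ be the product functional on $B(\ell^2)\odot\mathcal B$, determined by $(\rho_1\otimes\rho_2)(x\otimes b)=\rho_1(x)\rho_2(b)$. Let $\phi\colon C^*(F_\infty)\to B(\ell^2)$ be a bounded representation, i.e. a bounded linear multiplicative map (not assumed to be $*$-preserving or unital), with operator norm $\|\phi\|$. Then for all $n$, all $a_1,\dots,a_n\in C^*(F_\infty)$ and all $b_1,\dots,b_n\in\mathcal B$, the element $X=\sum_{i=1}^n\phi(a_i)\otimes b_i$ satisfies $(\rho_1\otimes\rho_2)(X^*X)\ge 0$ and $$\big((\rho_1\otimes\rho_2)(X^*X)\big)^{1/2}\le\|\phi\|^3\,\Big\|\sum_{i=1}^n a_i\otimes b_i\Big\|,$$ where the norm on the right is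 the unique $C^*$-norm on $C^*(F_\infty)\odot\mathcal B$. -/

import Mathlib

open scoped TensorProduct ComplexOrder ENNReal

noncomputable section

/-- The Hilbert space `ℓ²(ℕ)` over the complex numbers. -/
abbrev EllTwo : Type := lp (fun _ : ℕ => ℂ) 2

/-- The C⋆-algebra `B(ℓ²)` of bounded operators on `ℓ²(ℕ)`. -/
abbrev BEllTwo : Type := EllTwo →L[ℂ] EllTwo

instance : Nontrivial EllTwo :=
  ⟨lp.single 2 0 1, 0, fun h => by
    have h' : (lp.single 2 0 1 : EllTwo) 0 = 0 := by rw [h]; rfl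
    simp at h'⟩

/-! ### The full group C⋆-algebra of the free group on countably many generators -/

/-- The free group on countably infinitely many generators. -/
abbrev FreeGroupInf : Type := FreeGroup ℕ

/-- Unitary representations of the free group on `ℓ²(ℕ)`. The group being countable, each of its
cyclic unitary representations acts on a separable Hilbert space and hence is a subrepresentation
of one on `ℓ²(ℕ)`, so these determine the universal C⋆-norm of the group algebra. -/
abbrev FreeUnitaryRep : Type := FreeGroupInf →* unitary BEllTwo

/-- The C⋆-algebra of bounded families of operators, one operator on `ℓ²(ℕ)` for each unitary
representation of the free group, with the supremum norm. -/
abbrev FreeRepProduct : Type := lp (fun _ : FreeUnitaryRep => BEllTwo) ∞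

instance : CStarAlgebra FreeRepProduct where

theorem memℓp_freeUniversal (g : FreeGroupInf) :
    Memℓp (fun π : FreeUnitaryRep => (π g : BEllTwo)) ∞ :=
  memℓp_infty ⟨1, by
    rintro _ ⟨π, rfl⟩
    exact (CStarRing.norm_coe_unitary (π g)).le⟩

/-- The image of a group element in the universal representation: the family of its images under
all unitary representations. -/
def freeUniversal (g : FreeGroupInf) : FreeRepProduct :=
  ⟨fun π => (π g : BEllTwo), memℓp_freeUniversal g⟩

/-- The image of the group algebra in the universal representation, closed in norm. Its norm is
`‖∑ c_g g‖ = sup_π ‖∑ c_g π(g)‖`, that is, it is the completion of the group algebra for the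
universal C⋆-norm. -/
def fullFreeGroupSubalgebra : StarSubalgebra ℂ FreeRepProduct :=
  (StarAlgebra.adjoin ℂ (Set.range freeUniversal)).topologicalClosure

instance : CStarAlgebra fullFreeGroupSubalgebra :=
  StarSubalgebra.cstarAlgebra fullFreeGroupSubalgebra
    (h_closed := StarSubalgebra.isClosed_topologicalClosure _)

/-- The full group C⋆-algebra `C⋆(F_∞)`. -/
def CStarFreeInf : Type := fullFreeGroupSubalgebra

instance : CStarAlgebra CStarFreeInf := inferInstanceAs (CStarAlgebra fullFreeGroupSubalgebra)

/-! ### C⋆-norms on algebraic tensor products, nuclearity, states -/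

/-- `p` is a C⋆-norm on the algebraic tensor product `A ⊗ B`. -/
structure IsCStarNorm {A B : Type*} [NonUnitalCStarAlgebra A] [NonUnitalCStarAlgebra B]
    (p : Seminorm ℂ (A ⊗[ℂ] B)) : Prop where
  eq_zero_of_apply_eq_zero : ∀ x, p x = 0 → x = 0
  mul_le : ∀ x y, p (x * y) ≤ p x * p y
  star_mul_self : ∀ x, p (star x * x) = p x ^ 2

/-- A (not necessarily unital) C⋆-algebra `B` is nuclear if for every C⋆-algebra `A` there is
exactly one C⋆-norm on the algebraic tensor product `A ⊗ B`. It is enough to let `A` range over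
the algebras in `Type`: if two C⋆-norms differ at some `∑ aᵢ ⊗ bᵢ`, then they differ on the tensor
product of the separable C⋆-algebra generated by the `aᵢ` with `B`. -/
def IsNuclear (B : Type*) [NonUnitalCStarAlgebra B] : Prop :=
  ∀ (A : Type) [NonUnitalCStarAlgebra A], ∃! p : Seminorm ℂ (A ⊗[ℂ] B), IsCStarNorm p

/-- A state on a (not necessarily unital) C⋆-algebra: a positive linear functional of norm one. -/
structure IsState {A : Type*} [NonUnitalCStarAlgebra A] (ρ : A →L[ℂ] ℂ) : Prop where
  nonneg : ∀ x, 0 ≤ ρ (star x * x)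
  norm_eq_one : ‖ρ‖ = 1

/-- The product functional `ρ₁ ⊗ ρ₂`, determined by `a ⊗ b ↦ ρ₁ a * ρ₂ b`. -/
def tensorFunctional {A B : Type*} [NonUnitalCStarAlgebra A] [NonUnitalCStarAlgebra B]
    (ρ₁ : A →L[ℂ] ℂ) (ρ₂ : B →L[ℂ] ℂ) : A ⊗[ℂ] B →ₗ[ℂ] ℂ :=
  LinearMap.mul' ℂ ℂ ∘ₗ TensorProduct.map ρ₁.toLinearMap ρ₂.toLinearMap

end

/-!
Write `N x = ρ₁(x⋆x)` and let `u` be a unitary of `C⋆(F_∞)` for which `N (φ u)` is nearly maximal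
among all unitaries. A selfadjoint `s` of small norm is the average of the unitaries `s ± i√(1-s²)`.
Comparing `N (φ u)` with the values of `N ∘ φ` at `u (s ± i√(1-s²))` and expanding to second order
gives, up to a small error, `N (φ (us)) ≤ Re G_u(s²)`, where `G_u(x) = ρ₁(φ(u)⋆ φ(ux))`. A weak-⋆
cluster point `G` of the `G_u` along a maximising sequence satisfies `‖G‖ ≤ ‖φ‖²` and, since by
polar decomposition the general case reduces to selfadjoint elements at the cost of one factor
`‖φ‖²`, also `N (φ a) ≤ ‖φ‖² G(a⋆a)` for every `a`; its hermitian part is therefore positive.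

By the Schur product theorem this domination survives tensoring with `ρ₂`. Finally, left
multiplication on the GNS space of the product of two positive functionals defines a C⋆-seminorm on
the tensor product, and the supremum of a C⋆-seminorm and a C⋆-norm is a C⋆-norm, so a largest
C⋆-norm dominates it; approximate units of the two factors replace the cyclic vector. This loses
only `‖φ‖²`, and `‖φ‖² ≤ ‖φ‖³` because a nonzero multiplicative map of a unital algebra has norm at
least one.
-/

open Filter Topology

section PositiveForm

variable {E F : Type*} [AddCommGroup E] [Module ℂ E] [AddCommGroup F] [Module ℂ F]

theorem isSymm_of_isNonneg {S : E →ₗ⋆[ℂ] E →ₗ[ℂ] ℂ} (hS : S.IsNonneg) : S.IsSymm := by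
  refine ⟨fun x y => ?_⟩
  have im_diag (z : E) : (S z z).im = 0 := (Complex.nonneg_iff.1 (hS.nonneg z)).2.symm
  have hadd := im_diag (x + y)
  have haddI := im_diag (x + Complex.I • y)
  simp only [map_add, map_smulₛₗ, LinearMap.add_apply, LinearMap.smul_apply, Complex.add_im,
    RingHom.id_apply, smul_eq_mul, Complex.conj_I, Complex.add_re, Complex.mul_re, Complex.mul_im,
    Complex.neg_re, Complex.neg_im, Complex.I_re, Complex.I_im, im_diag, mul_zero, zero_mul,
    one_mul, neg_zero, neg_mul, add_zero, zero_add, sub_self] at hadd haddI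
  apply Complex.ext <;> simp only [Complex.conj_re, Complex.conj_im] <;> linarith

theorem posSemidef_of_isNonneg {ι : Type*} [Finite ι] {S : E →ₗ⋆[ℂ] E →ₗ[ℂ] ℂ} (hS : S.IsNonneg)
    (x : ι → E) : (Matrix.of fun i j => S (x i) (x j)).PosSemidef := by
  cases nonempty_fintype ι
  refine Matrix.posSemidef_iff_dotProduct_mulVec.2 ⟨?_, fun c => ?_⟩
  · ext i j
    simpa using (isSymm_of_isNonneg hS).eq (x j) (x i)
  · convert hS.nonneg (∑ i, c i • x i) using 1
    simp only [dotProduct, Matrix.mulVec, Matrix.of_apply, map_sum, LinearMap.sum_apply,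
      LinearMap.map_smulₛₗ, LinearMap.smul_apply, smul_eq_mul, Pi.star_apply, Finset.mul_sum,
      RingHom.id_apply, starRingEnd_apply]
    rw [Finset.sum_comm]
    exact Finset.sum_congr rfl fun i _ => Finset.sum_congr rfl fun j _ => by ring

variable {ι : Type*} [Fintype ι]

theorem sum_sum_mul_nonneg_of_isNonneg {S : E →ₗ⋆[ℂ] E →ₗ[ℂ] ℂ} (hS : S.IsNonneg)
    {T : F →ₗ⋆[ℂ] F →ₗ[ℂ] ℂ} (hT : T.IsNonneg) (x : ι → E) (y : ι → F) :
    0 ≤ ∑ i, ∑ j, S (x i) (x j) * T (y i) (y j) := by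
  have schur := ((posSemidef_of_isNonneg hS x).hadamard
    (posSemidef_of_isNonneg hT y)).dotProduct_mulVec_nonneg 1
  simpa [dotProduct, Matrix.mulVec, Matrix.hadamard] using schur

theorem sum_sum_mul_le_of_isNonneg {S S' : E →ₗ⋆[ℂ] E →ₗ[ℂ] ℂ} {T T' : F →ₗ⋆[ℂ] F →ₗ[ℂ] ℂ}
    (hS : (S' - S).IsNonneg) (hT : (T' - T).IsNonneg) (hS' : S'.IsNonneg) (hT₀ : T.IsNonneg)
    (x : ι → E) (y : ι → F) :
    ∑ i, ∑ j, S (x i) (x j) * T (y i) (y j) ≤ ∑ i, ∑ j, S' (x i) (x j) * T' (y i) (y j) := by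
  calc ∑ i, ∑ j, S (x i) (x j) * T (y i) (y j)
      ≤ ∑ i, ∑ j, S' (x i) (x j) * T (y i) (y j) := by
        simpa [sub_mul] using sum_sum_mul_nonneg_of_isNonneg hS hT₀ x y
    _ ≤ ∑ i, ∑ j, S' (x i) (x j) * T' (y i) (y j) := by
        simpa [mul_sub] using sum_sum_mul_nonneg_of_isNonneg hS' hT x y

end PositiveForm

section GNS

variable {D : Type*} [NonUnitalRing D] [StarRing D] [Module ℂ D]

/-- The squared GNS seminorm `‖x‖_ω² = ω (x⋆ x)` of a functional `ω` on a ⋆-algebra. Taking the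
real part makes it an honest real number; for a positive `ω` nothing is lost. -/
def gnsNormSq (ω : D →ₗ[ℂ] ℂ) (x : D) : ℝ := (ω (star x * x)).re

theorem ofReal_gnsNormSq {ω : D →ₗ[ℂ] ℂ} (hω : ∀ x, 0 ≤ ω (star x * x)) (x : D) :
    (gnsNormSq ω x : ℂ) = ω (star x * x) :=
  Complex.ext rfl (Complex.nonneg_iff.1 (hω x)).2

theorem gnsNormSq_nonneg {ω : D →ₗ[ℂ] ℂ} (hω : ∀ x, 0 ≤ ω (star x * x)) (x : D) :
    0 ≤ gnsNormSq ω x :=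
  (Complex.nonneg_iff.1 (hω x)).1

theorem gnsNormSq_add_add_gnsNormSq_sub (ω : D →ₗ[ℂ] ℂ) (x y : D) :
    gnsNormSq ω (x + y) + gnsNormSq ω (x - y) = 2 * (gnsNormSq ω x + gnsNormSq ω y) := by
  simp only [gnsNormSq, star_add, star_sub, add_mul, sub_mul, mul_add, mul_sub, map_add, map_sub,
    Complex.add_re, Complex.sub_re]
  ring

theorem gnsNormSq_add_le {ω : D →ₗ[ℂ] ℂ} (hω : ∀ x, 0 ≤ ω (star x * x)) (x y : D) :
    gnsNormSq ω (x + y) ≤ 2 * (gnsNormSq ω x + gnsNormSq ω y) := by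
  linarith [gnsNormSq_add_add_gnsNormSq_sub ω x y, gnsNormSq_nonneg hω (x - y)]

/-- A C⋆-seminorm on a ⋆-algebra: a submultiplicative seminorm satisfying the C⋆-identity. -/
structure IsCStarSeminorm (q : Seminorm ℂ D) : Prop where
  mul_le : ∀ x y, q (x * y) ≤ q x * q y
  star_mul_self : ∀ x, q (star x * x) = q x ^ 2

theorem IsCStarSeminorm.sup {p q : Seminorm ℂ D} (hp : IsCStarSeminorm p)
    (hq : IsCStarSeminorm q) : IsCStarSeminorm (p ⊔ q) where
  mul_le x y := by
    refine sup_le ((hp.mul_le x y).trans ?_) ((hq.mul_le x y).trans ?_)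
    · exact mul_le_mul le_sup_left le_sup_left (apply_nonneg p y) (apply_nonneg (p ⊔ q) x)
    · exact mul_le_mul le_sup_right le_sup_right (apply_nonneg q y) (apply_nonneg (p ⊔ q) x)
  star_mul_self x := by
    simp only [Seminorm.sup_apply, hp.star_mul_self, hq.star_mul_self]
    exact ((pow_left_monotoneOn (n := 2)).map_max (apply_nonneg p x) (apply_nonneg q x)).symm

variable [IsScalarTower ℂ D D] [SMulCommClass ℂ D D] [StarModule ℂ D]

theorem gnsNormSq_smul (ω : D →ₗ[ℂ] ℂ) (c : ℂ) (x : D) :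
    gnsNormSq ω (c • x) = ‖c‖ ^ 2 * gnsNormSq ω x := by
  rw [gnsNormSq, star_smul, smul_mul_smul_comm, map_smul, Complex.star_def, Complex.conj_mul',
    smul_eq_mul, ← Complex.ofReal_pow, Complex.re_ofReal_mul, gnsNormSq]

/-- The sesquilinear form `(x, y) ↦ ω (x⋆ y)` underlying the GNS construction. -/
def gramForm (ω : D →ₗ[ℂ] ℂ) : D →ₗ⋆[ℂ] D →ₗ[ℂ] ℂ :=
  LinearMap.mk₂'ₛₗ (starRingEnd ℂ) (RingHom.id ℂ) (fun x y => ω (star x * y))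
    (fun x y z => by simp only [star_add, add_mul, map_add])
    (fun c x y => by simp only [star_smul, smul_mul_assoc, map_smul]; rfl)
    (fun x y z => by simp only [mul_add, map_add])
    (fun c x y => by simp only [mul_smul_comm, map_smul]; rfl)

@[simp]
theorem gramForm_apply (ω : D →ₗ[ℂ] ℂ) (x y : D) : gramForm ω x y = ω (star x * y) := rfl

theorem gramForm_isSymm {ω : D →ₗ[ℂ] ℂ} (hω : ∀ x, 0 ≤ ω (star x * x)) : (gramForm ω).IsSymm :=
  isSymm_of_isNonneg ⟨hω⟩

theorem gnsNormSq_sub {ω : D →ₗ[ℂ] ℂ} (hω : ∀ x, 0 ≤ ω (star x * x)) (x y : D) :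
    gnsNormSq ω (x - y) = gnsNormSq ω x - 2 * (ω (star x * y)).re + gnsNormSq ω y := by
  have hsymm : (ω (star y * x)).re = (ω (star x * y)).re := by
    rw [← gramForm_apply ω x y, ← (gramForm_isSymm hω).eq y x, Complex.conj_re, gramForm_apply]
  simp only [gnsNormSq, star_sub, sub_mul, mul_sub, map_sub, Complex.sub_re, hsymm]
  ring

variable {D' : Type*} [NonUnitalRing D'] [StarRing D'] [Module ℂ D'] [IsScalarTower ℂ D' D']
  [SMulCommClass ℂ D' D'] [StarModule ℂ D']

theorem isNonneg_smul_gramForm_sub_comp {ω : D →ₗ[ℂ] ℂ} {σ : D' →ₗ[ℂ] ℂ}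
    (hω : ∀ x, 0 ≤ ω (star x * x)) (hσ : ∀ x, 0 ≤ σ (star x * x)) {f : D →ₗ[ℂ] D'} {K : ℝ}
    (hf : ∀ x, gnsNormSq σ (f x) ≤ K * gnsNormSq ω x) :
    ((K : ℂ) • gramForm ω - (gramForm σ ∘ₛₗ f).compl₂ f).IsNonneg where
  nonneg x := by
    rw [LinearMap.sub_apply, LinearMap.sub_apply, LinearMap.smul_apply, LinearMap.smul_apply,
      LinearMap.compl₂_apply, LinearMap.comp_apply, gramForm_apply, gramForm_apply,
      ← ofReal_gnsNormSq hω, ← ofReal_gnsNormSq hσ, sub_nonneg, smul_eq_mul]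
    exact_mod_cast hf x

end GNS

section LeftRegular

section FormalAdjoint

variable {E : Type*} [SeminormedAddCommGroup E] [InnerProductSpace ℂ E] {S T : E →L[ℂ] E}

theorem norm_sq_le_norm_comp_of_formalAdjoint
    (hST : ∀ x y, inner ℂ (S x) y = inner ℂ x (T y)) : ‖T‖ ^ 2 ≤ ‖S ∘L T‖ := by
  refine (Real.le_sqrt T.opNorm_nonneg (S ∘L T).opNorm_nonneg).1 ?_
  refine T.opNorm_le_bound (Real.sqrt_nonneg _) fun z => ?_
  refine le_of_sq_le_sq ?_ (by positivity)
  rw [mul_pow, Real.sq_sqrt (S ∘L T).opNorm_nonneg]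
  calc ‖T z‖ ^ 2 = RCLike.re (inner ℂ ((S ∘L T) z) z) := by
        rw [ContinuousLinearMap.comp_apply, hST, inner_self_eq_norm_sq]
    _ ≤ ‖(S ∘L T) z‖ * ‖z‖ := re_inner_le_norm _ _
    _ ≤ ‖S ∘L T‖ * ‖z‖ * ‖z‖ := by gcongr; exact (S ∘L T).le_opNorm z
    _ = ‖S ∘L T‖ * ‖z‖ ^ 2 := by ring

theorem norm_le_norm_of_formalAdjoint (hST : ∀ x y, inner ℂ (S x) y = inner ℂ x (T y)) :
    ‖T‖ ≤ ‖S‖ := by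
  have hsq : ‖T‖ ^ 2 ≤ ‖S‖ * ‖T‖ :=
    (norm_sq_le_norm_comp_of_formalAdjoint hST).trans (S.opNorm_comp_le T)
  nlinarith [S.opNorm_nonneg, T.opNorm_nonneg]

theorem norm_comp_of_formalAdjoint (hST : ∀ x y, inner ℂ (S x) y = inner ℂ x (T y)) :
    ‖S ∘L T‖ = ‖T‖ ^ 2 := by
  have hTS (x y : E) : inner ℂ (T x) y = inner ℂ x (S y) := by
    rw [← inner_conj_symm, ← hST, inner_conj_symm]
  refine le_antisymm ?_ (norm_sq_le_norm_comp_of_formalAdjoint hST)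
  grw [S.opNorm_comp_le, norm_le_norm_of_formalAdjoint hTS, sq]

end FormalAdjoint

variable {D : Type*} [NonUnitalRing D] [StarRing D] [Module ℂ D] [IsScalarTower ℂ D D]
  [SMulCommClass ℂ D D] [StarModule ℂ D]

theorem exists_isCStarSeminorm_gnsNormSq_mul_le {ω : D →ₗ[ℂ] ℂ} (hω : ∀ x, 0 ≤ ω (star x * x))
    (hbdd : ∀ y, ∃ C, ∀ z, gnsNormSq ω (y * z) ≤ C * gnsNormSq ω z) :
    ∃ q : Seminorm ℂ D, IsCStarSeminorm q ∧
      ∀ y z, gnsNormSq ω (y * z) ≤ q y ^ 2 * gnsNormSq ω z := by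
  let core : PreInnerProductSpace.Core ℂ D :=
    { inner := fun x y => gramForm ω x y
      conj_inner_symm := fun x y => (gramForm_isSymm hω).eq y x
      re_inner_nonneg := gnsNormSq_nonneg hω
      add_left := fun x y z => by rw [map_add, LinearMap.add_apply]
      smul_left := fun x y c => by rw [map_smulₛₗ, LinearMap.smul_apply, smul_eq_mul] }
  let _ : SeminormedAddCommGroup D := InnerProductSpace.Core.toSeminormedAddCommGroup (c := core)
  let _ : InnerProductSpace ℂ D := InnerProductSpace.ofCore core
  have gnsNormSq_eq (x : D) : gnsNormSq ω x = ‖x‖ ^ 2 := inner_self_eq_norm_sq (𝕜 := ℂ) x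
  have mulLeft_bounded (y : D) : ∃ C : ℝ, ∀ z, ‖LinearMap.mulLeft ℂ y z‖ ≤ C * ‖z‖ := by
    obtain ⟨C, hC⟩ := hbdd y
    refine ⟨√(max C 0), fun z => le_of_sq_le_sq ?_ (by positivity)⟩
    rw [mul_pow, Real.sq_sqrt (le_max_right _ _), LinearMap.mulLeft_apply, ← gnsNormSq_eq,
      ← gnsNormSq_eq]
    exact (hC z).trans (mul_le_mul_of_nonneg_right (le_max_left _ _) (gnsNormSq_nonneg hω z))
  let L : D →ₗ[ℂ] D →L[ℂ] D :=
    { toFun := fun y => (LinearMap.mulLeft ℂ y).mkContinuousOfExistsBound (mulLeft_bounded y)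
      map_add' := fun x y => by ext z; exact add_mul x y z
      map_smul' := fun c y => by ext z; exact smul_mul_assoc c y z }
  have L_mul (x y : D) : L (x * y) = L x ∘L L y := by ext z; exact mul_assoc x y z
  have L_star (x y z : D) : inner ℂ (L (star x) y) z = inner ℂ y (L x z) := by
    change ω (star (star x * y) * z) = ω (star y * (x * z))
    rw [star_mul, star_star, mul_assoc]
  refine ⟨(normSeminorm ℂ (D →L[ℂ] D)).comp L, ⟨fun x y => ?_, fun x => ?_⟩, fun y z => ?_⟩
  · simp only [Seminorm.comp_apply, coe_normSeminorm, L_mul]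
    exact (L x).opNorm_comp_le (L y)
  · simp only [Seminorm.comp_apply, coe_normSeminorm, L_mul]
    exact norm_comp_of_formalAdjoint (L_star x)
  · rw [gnsNormSq_eq, gnsNormSq_eq, ← mul_pow]
    exact pow_le_pow_left₀ (norm_nonneg _) ((L y).le_opNorm z) 2

end LeftRegular

section PositiveFunctional

variable {D : Type*} [NonUnitalCStarAlgebra D]

theorem gnsNormSq_mul_le {ρ : D →L[ℂ] ℂ} (hρ : ∀ x, 0 ≤ ρ (star x * x)) (b x : D) :
    gnsNormSq ρ (b * x) ≤ ‖b‖ ^ 2 * gnsNormSq ρ x := by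
  let _ := CStarAlgebra.spectralOrder D
  let _ := CStarAlgebra.spectralOrderedRing D
  have hle : star (b * x) * (b * x) ≤ ‖b‖ ^ 2 • (star x * x) := by
    simpa only [star_mul, mul_assoc, CStarRing.norm_star_mul_self, ← sq] using
      CStarAlgebra.star_left_conjugate_le_norm_smul (a := x) (b := star b * b)
  obtain ⟨y, hy⟩ := CStarAlgebra.nonneg_iff_eq_star_mul_self.1 (sub_nonneg.2 hle)
  have hdiff : 0 ≤ (ρ (‖b‖ ^ 2 • (star x * x) - star (b * x) * (b * x))).re :=
    hy ▸ gnsNormSq_nonneg hρ y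
  rwa [map_sub, Complex.sub_re, sub_nonneg, ← Complex.coe_smul, map_smul, smul_eq_mul,
    Complex.re_ofReal_mul] at hdiff

theorem gnsNormSq_le (ρ : D →L[ℂ] ℂ) (x : D) : gnsNormSq ρ x ≤ ‖ρ‖ * ‖x‖ ^ 2 := by
  refine (Complex.re_le_norm _).trans ((ρ.le_opNorm _).trans_eq ?_)
  rw [CStarRing.norm_star_mul_self, sq]

theorem gnsNormSq_le_of_norm_le_one (ρ : D →L[ℂ] ℂ) {x : D} (hx : ‖x‖ ≤ 1) :
    gnsNormSq ρ x ≤ ‖ρ‖ :=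
  (gnsNormSq_le ρ x).trans
    (mul_le_of_le_one_right (norm_nonneg ρ) (pow_le_one₀ (norm_nonneg x) hx))

end PositiveFunctional

section FunctionalCalculus

variable {A : Type*} [CStarAlgebra A]

theorem norm_le_one_of_mem_unitary {u : A} (hu : u ∈ unitary A) : ‖u‖ ≤ 1 := by
  obtain _ | _ := subsingleton_or_nontrivial A
  · simp [Subsingleton.elim u 0]
  · exact (CStarRing.norm_of_mem_unitary hu).le

theorem norm_one_sub_cfcSqrt_le [PartialOrder A] [StarOrderedRing A] {b : A} (hb₀ : 0 ≤ b)
    (hb₁ : b ≤ 1) : ‖1 - CFC.sqrt b‖ ≤ ‖1 - b‖ := by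
  have sqrt_le_one : CFC.sqrt b ≤ 1 := by
    simpa using CFC.sqrt_le_sqrt b 1 hb₁
  have le_sqrt : b ≤ CFC.sqrt b := by
    simpa [CFC.sq_sqrt b hb₀] using
      CStarAlgebra.pow_antitone (CFC.sqrt_nonneg b) sqrt_le_one one_le_two
  exact CStarAlgebra.norm_le_norm_of_nonneg_of_le (sub_nonneg.2 sqrt_le_one)
    (sub_le_sub_left le_sqrt 1)

theorem exists_add_I_smul_mem_unitary {s : A} (hs : IsSelfAdjoint s) (hs₁ : ‖s‖ ≤ 1) :
    ∃ c : A, s + Complex.I • c ∈ unitary A ∧ s - Complex.I • c ∈ unitary A ∧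
      s ^ 2 = 1 - c ^ 2 ∧ ‖1 - c‖ ≤ ‖s‖ ^ 2 := by
  let _ := CStarAlgebra.spectralOrder A
  let _ := CStarAlgebra.spectralOrderedRing A
  have norm_sq : ‖s ^ 2‖ = ‖s‖ ^ 2 := by rw [sq, hs.norm_mul_self]
  have sq_le_one : s ^ 2 ≤ 1 :=
    (CStarAlgebra.norm_le_one_iff_of_nonneg _ hs.sq_nonneg).1
      (norm_sq.trans_le (pow_le_one₀ (norm_nonneg s) hs₁))
  refine ⟨CFC.sqrt (1 - s ^ 2), hs.self_add_I_smul_cfcSqrt_sub_sq_mem_unitary s hs₁, ?_, ?_, ?_⟩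
  · rw [← selfAdjoint.star_coe_unitarySelfAddISMul ⟨s, hs⟩ hs₁]
    exact (star (selfAdjoint.unitarySelfAddISMul ⟨s, hs⟩ hs₁)).2
  · rw [CFC.sq_sqrt _ (sub_nonneg.2 sq_le_one), sub_sub_cancel]
  · refine (norm_one_sub_cfcSqrt_le (sub_nonneg.2 sq_le_one) ?_).trans_eq ?_
    · exact sub_le_self 1 hs.sq_nonneg
    · rw [sub_sub_cancel, norm_sq]

theorem exists_regularized_polarDecomposition {ε : ℝ} (hε : 0 < ε) (a : A) :
    ∃ v h : A, v * h = a ∧ ‖v‖ ≤ 1 ∧ IsSelfAdjoint h ∧ h ^ 2 = star a * a + ε • (1 : A) := by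
  let _ := CStarAlgebra.spectralOrder A
  let _ := CStarAlgebra.spectralOrderedRing A
  have hpos : IsStrictlyPositive (star a * a + ε • (1 : A)) :=
    .nonneg_add (star_mul_self_nonneg a) (.smul hε isStrictlyPositive_one)
  obtain ⟨h, h_def⟩ : IsUnit (CFC.sqrt (star a * a + ε • (1 : A))) := hpos.isUnit_cfcSqrt
  have h_sa : IsSelfAdjoint (h : A) := h_def ▸ (CFC.sqrt_nonneg _).isSelfAdjoint
  have h_sq : (h : A) ^ 2 = star a * a + ε • (1 : A) := h_def ▸ CFC.sq_sqrt _ hpos.nonneg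
  have star_mul_self_le : star a * a ≤ star (h : A) * h := by
    rw [h_sa.star_eq, ← sq, h_sq]
    exact le_add_of_nonneg_right (smul_nonneg hε.le zero_le_one)
  refine ⟨a * ↑h⁻¹, h, h.inv_mul_cancel_right a, ?_, h_sa, h_sq⟩
  rw [← sq_le_one_iff₀ (norm_nonneg _), sq, ← CStarRing.norm_star_mul_self,
    CStarAlgebra.norm_le_one_iff_of_nonneg _ (star_mul_self_nonneg _)]
  calc star (a * ↑h⁻¹) * (a * ↑h⁻¹) = star (↑h⁻¹ : A) * (star a * a) * ↑h⁻¹ := by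
        simp only [star_mul, mul_assoc]
    _ ≤ star (↑h⁻¹ : A) * (star (h : A) * h) * ↑h⁻¹ :=
        star_left_conjugate_le_conjugate star_mul_self_le _
    _ = 1 := by
        rw [← mul_assoc, ← star_mul, h.mul_inv, star_one, one_mul, h.mul_inv]

end FunctionalCalculus

theorem exists_tendsto_strongDual_of_norm_le {𝕜 E ι : Type*} [NontriviallyNormedField 𝕜]
    [ProperSpace 𝕜] [SeminormedAddCommGroup E] [NormedSpace 𝕜 E] (l : Ultrafilter ι)
    {g : ι → StrongDual 𝕜 E} {K : ℝ} (hg : ∀ i, ‖g i‖ ≤ K) :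
    ∃ G : StrongDual 𝕜 E, ‖G‖ ≤ K ∧ ∀ x, Tendsto (fun i => g i x) l (𝓝 (G x)) := by
  obtain ⟨G, hGK, hG⟩ := (WeakDual.isCompact_closedBall (0 : StrongDual 𝕜 E) K).ultrafilter_le_nhds'
    (l.map fun i => StrongDual.toWeakDual (g i))
    (Filter.mem_map.2 (Filter.univ_mem' fun i => by simpa using hg i))
  exact ⟨WeakDual.toStrongDual G, by simpa using hGK,
    fun x => ((WeakDual.eval_continuous x).tendsto G).comp hG⟩

section BoundedHomomorphism

variable {A C : Type*} [CStarAlgebra A] [NonUnitalCStarAlgebra C] {φ : A →L[ℂ] C} {ρ : C →L[ℂ] ℂ}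

/-- The functional `x ↦ ρ (φ(u)⋆ φ(u x))`. For a unitary `u` that nearly maximises
`gnsNormSq ρ ∘ φ` over the unitary group it is nearly a positive functional dominating
`gnsNormSq ρ ∘ φ`. -/
noncomputable def translatedFunctional (φ : A →L[ℂ] C) (ρ : C →L[ℂ] ℂ) (u : A) : A →L[ℂ] ℂ :=
  ρ ∘L ContinuousLinearMap.mul ℂ C (star (φ u)) ∘L φ ∘L ContinuousLinearMap.mul ℂ A u

theorem translatedFunctional_apply (φ : A →L[ℂ] C) (ρ : C →L[ℂ] ℂ) (u x : A) :
    translatedFunctional φ ρ u x = ρ (star (φ u) * φ (u * x)) := rfl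

theorem norm_translatedFunctional_le (φ : A →L[ℂ] C) (ρ : C →L[ℂ] ℂ) {u : A}
    (hu : u ∈ unitary A) : ‖translatedFunctional φ ρ u‖ ≤ ‖ρ‖ * ‖φ‖ ^ 2 := by
  refine ContinuousLinearMap.opNorm_le_bound _ (by positivity) fun x => ?_
  calc ‖ρ (star (φ u) * φ (u * x))‖ ≤ ‖ρ‖ * (‖star (φ u)‖ * ‖φ (u * x)‖) :=
        (ρ.le_opNorm _).trans (by gcongr; exact norm_mul_le _ _)
    _ ≤ ‖ρ‖ * (‖φ‖ * (‖φ‖ * ‖x‖)) := by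
        rw [norm_star, ← CStarRing.norm_mem_unitary_mul x hu]
        gcongr
        · exact φ.unit_le_opNorm u (norm_le_one_of_mem_unitary hu)
        · exact φ.le_opNorm _
    _ = ‖ρ‖ * ‖φ‖ ^ 2 * ‖x‖ := by ring

theorem gnsNormSq_map_le_of_mem_unitary (φ : A →L[ℂ] C) (ρ : C →L[ℂ] ℂ) {u : A}
    (hu : u ∈ unitary A) : gnsNormSq ρ (φ u) ≤ ‖ρ‖ * ‖φ‖ ^ 2 := by
  refine (gnsNormSq_le ρ (φ u)).trans ?_
  gcongr
  exact φ.unit_le_opNorm u (norm_le_one_of_mem_unitary hu)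

section NearMaximizer

variable {M : ℝ} {u : A}

/- A selfadjoint contraction `s` is the average of the unitaries `s ± i c`, where
`c = √(1 - s²)`. Since `u (s ± i c)` does not beat `M`, the parallelogram law bounds
`N(us) + N(uc)` by `M`, and `1 - c = s²/2 + O(s⁴)` turns `N(uc)` into `N(u) - G_u(s²)` up to an
error of fourth order. -/
theorem gnsNormSq_map_mul_le_add_of_norm_le_one (hρ : ∀ x, 0 ≤ ρ (star x * x))
    (hM : ∀ w ∈ unitary A, gnsNormSq ρ (φ w) ≤ M) (hu : u ∈ unitary A) {s : A}
    (hs : IsSelfAdjoint s) (hs₁ : ‖s‖ ≤ 1) :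
    gnsNormSq ρ (φ (u * s)) ≤ (M - gnsNormSq ρ (φ u)) + (translatedFunctional φ ρ u (s ^ 2)).re +
      ‖ρ‖ * ‖φ‖ ^ 2 * ‖s‖ ^ 4 := by
  obtain ⟨c, hadd, hsub, hsq, hnorm⟩ := exists_add_I_smul_mem_unitary hs hs₁
  set G := translatedFunctional φ ρ u with G_def
  set d := 1 - c with d_def
  have sum_le : gnsNormSq ρ (φ (u * s)) + gnsNormSq ρ (φ (u * c)) ≤ M := by
    have hadd' := hM _ (mul_mem hu hadd)
    have hsub' := hM _ (mul_mem hu hsub)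
    rw [mul_add, mul_smul_comm, map_add, map_smul] at hadd'
    rw [mul_sub, mul_smul_comm, map_sub, map_smul] at hsub'
    have hpar := gnsNormSq_add_add_gnsNormSq_sub (ρ : C →ₗ[ℂ] ℂ) (φ (u * s))
      (Complex.I • φ (u * c))
    rw [gnsNormSq_smul, Complex.norm_I, one_pow, one_mul] at hpar
    linarith
  have le_cos : gnsNormSq ρ (φ u) - 2 * (G d).re ≤ gnsNormSq ρ (φ (u * c)) := by
    have hc : φ (u * c) = φ u - φ (u * d) := by
      rw [← map_sub, d_def, mul_sub, mul_one, sub_sub_cancel]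
    have hcos := gnsNormSq_sub (ω := ρ) hρ (φ u) (φ (u * d))
    rw [← hc, ContinuousLinearMap.coe_coe, ← translatedFunctional_apply, ← G_def] at hcos
    linarith [gnsNormSq_nonneg (ω := ρ) hρ (φ (u * d))]
  have second_order : 2 * (G d).re = (G (s ^ 2)).re + (G (d ^ 2)).re := by
    have hd : d + d = s ^ 2 + d ^ 2 := by rw [hsq, d_def]; noncomm_ring
    rw [← Complex.add_re, ← map_add, ← hd, map_add, Complex.add_re, two_mul]
  have remainder : (G (d ^ 2)).re ≤ ‖ρ‖ * ‖φ‖ ^ 2 * ‖s‖ ^ 4 := calc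
    (G (d ^ 2)).re ≤ ‖G‖ * ‖d ^ 2‖ := (Complex.re_le_norm _).trans (G.le_opNorm _)
    _ ≤ ‖ρ‖ * ‖φ‖ ^ 2 * (‖s‖ ^ 2) ^ 2 := by
        gcongr
        · exact norm_translatedFunctional_le φ ρ hu
        · exact (norm_pow_le' d two_pos).trans (by gcongr)
    _ = ‖ρ‖ * ‖φ‖ ^ 2 * ‖s‖ ^ 4 := by ring
  linarith

theorem gnsNormSq_map_mul_le_add_of_sub_le_pow (hρ : ∀ x, 0 ≤ ρ (star x * x))
    (hM : ∀ w ∈ unitary A, gnsNormSq ρ (φ w) ≤ M) (hu : u ∈ unitary A) {t : ℝ} (ht : 0 < t)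
    (htu : M - gnsNormSq ρ (φ u) ≤ t ^ 4) {h : A} (hh : IsSelfAdjoint h) (hth : t * ‖h‖ ≤ 1) :
    gnsNormSq ρ (φ (u * h)) ≤ (translatedFunctional φ ρ u (h ^ 2)).re +
      t ^ 2 * (1 + ‖ρ‖ * ‖φ‖ ^ 2 * ‖h‖ ^ 4) := by
  have norm_smul_h : ‖(t : ℂ) • h‖ = t * ‖h‖ := by
    rw [norm_smul, Complex.norm_of_nonneg ht.le]
  have hle := gnsNormSq_map_mul_le_add_of_norm_le_one hρ hM hu (s := (t : ℂ) • h)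
    (IsSelfAdjoint.smul (Complex.conj_ofReal t) hh) (norm_smul_h.trans_le hth)
  rw [norm_smul_h, mul_smul_comm, map_smul, gnsNormSq_smul, smul_pow, map_smul, smul_eq_mul,
    ← Complex.ofReal_pow, Complex.re_ofReal_mul, Complex.norm_of_nonneg ht.le] at hle
  refine le_of_mul_le_mul_left ?_ (pow_pos ht 2)
  calc t ^ 2 * gnsNormSq ρ (φ (u * h))
      ≤ t ^ 4 + t ^ 2 * (translatedFunctional φ ρ u (h ^ 2)).re +
        ‖ρ‖ * ‖φ‖ ^ 2 * (t * ‖h‖) ^ 4 := by linarith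
    _ = t ^ 2 * ((translatedFunctional φ ρ u (h ^ 2)).re +
        t ^ 2 * (1 + ‖ρ‖ * ‖φ‖ ^ 2 * ‖h‖ ^ 4)) := by ring

end NearMaximizer

theorem gnsNormSq_map_mul_le_of_norm_le_one (hφ : ∀ x y, φ (x * y) = φ x * φ y)
    (hρ : ∀ x, 0 ≤ ρ (star x * x)) {u v : A} (hu : u ∈ unitary A) (hv : ‖v‖ ≤ 1) (h : A) :
    gnsNormSq ρ (φ (v * h)) ≤ ‖φ‖ ^ 2 * gnsNormSq ρ (φ (u * h)) := by
  have hfactor : φ (v * h) = φ (v * star u) * φ (u * h) := by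
    rw [← hφ, mul_assoc, ← mul_assoc (star u), Unitary.star_mul_self_of_mem hu, one_mul]
  rw [hfactor]
  refine (gnsNormSq_mul_le hρ _ _).trans ?_
  gcongr
  · exact gnsNormSq_nonneg hρ _
  · refine φ.unit_le_opNorm _ ?_
    rwa [CStarRing.norm_mul_mem_unitary v (Unitary.star_mem hu)]

theorem exists_functional_gnsNormSq_map_mul_le (hφ : ∀ x y, φ (x * y) = φ x * φ y)
    (hρ : ∀ x, 0 ≤ ρ (star x * x)) :
    ∃ G : A →L[ℂ] ℂ, ‖G‖ ≤ ‖ρ‖ * ‖φ‖ ^ 2 ∧ ∀ v h : A, ‖v‖ ≤ 1 → IsSelfAdjoint h →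
      gnsNormSq ρ (φ (v * h)) ≤ ‖φ‖ ^ 2 * (G (h ^ 2)).re := by
  have hbdd : BddAbove (Set.range fun w : unitary A => gnsNormSq ρ (φ w)) :=
    ⟨‖ρ‖ * ‖φ‖ ^ 2, by rintro _ ⟨w, rfl⟩; exact gnsNormSq_map_le_of_mem_unitary φ ρ w.2⟩
  set M := ⨆ w : unitary A, gnsNormSq ρ (φ w)
  have hM (w : A) (hw : w ∈ unitary A) : gnsNormSq ρ (φ w) ≤ M := le_ciSup hbdd ⟨w, hw⟩
  let t (n : ℕ) : ℝ := 1 / ((n : ℝ) + 1)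
  have t_pos (n : ℕ) : 0 < t n := by positivity
  have t_tendsto : Tendsto t (hyperfilter ℕ) (𝓝 0) :=
    tendsto_one_div_add_atTop_nhds_zero_nat.mono_left Nat.hyperfilter_le_atTop
  have near_max (n : ℕ) : ∃ u : unitary A, M - t n ^ 4 < gnsNormSq ρ (φ u) :=
    exists_lt_of_lt_ciSup (sub_lt_self M (pow_pos (t_pos n) 4))
  choose u hu using near_max
  obtain ⟨G, hGK, hG⟩ := exists_tendsto_strongDual_of_norm_le (hyperfilter ℕ)
    fun n => norm_translatedFunctional_le φ ρ (u n).2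
  refine ⟨G, hGK, fun v h hv hh => ?_⟩
  have bound_tendsto : Tendsto (fun n => ‖φ‖ ^ 2 * ((translatedFunctional φ ρ (u n) (h ^ 2)).re +
      t n ^ 2 * (1 + ‖ρ‖ * ‖φ‖ ^ 2 * ‖h‖ ^ 4))) (hyperfilter ℕ) (𝓝 (‖φ‖ ^ 2 * (G (h ^ 2)).re)) := by
    simpa using ((Complex.continuous_re.tendsto _).comp (hG (h ^ 2)) |>.add
      ((t_tendsto.pow 2).mul_const _)).const_mul (‖φ‖ ^ 2)
  have t_small : ∀ᶠ n in hyperfilter ℕ, t n * ‖h‖ < 1 := by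
    refine (t_tendsto.mul_const ‖h‖).eventually_lt_const ?_
    rw [zero_mul]
    exact one_pos
  refine ge_of_tendsto bound_tendsto ?_
  filter_upwards [t_small] with n hn
  refine (gnsNormSq_map_mul_le_of_norm_le_one hφ hρ (u n).2 hv h).trans ?_
  gcongr
  exact gnsNormSq_map_mul_le_add_of_sub_le_pow hρ hM (u n).2 (t_pos n) (by linarith [hu n]) hh hn.le

theorem gnsNormSq_map_le_of_forall_mul_le {G : A →L[ℂ] ℂ} {K : ℝ}
    (hG : ∀ v h : A, ‖v‖ ≤ 1 → IsSelfAdjoint h →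
      gnsNormSq ρ (φ (v * h)) ≤ K * (G (h ^ 2)).re) (a : A) :
    gnsNormSq ρ (φ a) ≤ K * gnsNormSq G a := by
  have tendsto_zero : Tendsto (fun ε : ℝ => K * (G (star a * a + ε • (1 : A))).re) (𝓝[>] 0)
      (𝓝 (K * gnsNormSq G a)) :=
    (Continuous.tendsto' (by fun_prop) _ _ (by simp [gnsNormSq])).mono_left nhdsWithin_le_nhds
  refine ge_of_tendsto tendsto_zero (eventually_nhdsWithin_of_forall fun ε hε => ?_)
  obtain ⟨v, h, rfl, hv, hh, h_sq⟩ := exists_regularized_polarDecomposition hε a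
  exact h_sq ▸ hG v h hv hh

/-- The hermitian part `x ↦ (G x + conj (G x⋆)) / 2` of a functional. It is real on
selfadjoint elements, which makes a functional with nonnegative real part on squares positive. -/
noncomputable def hermitianPart (G : A →L[ℂ] ℂ) : A →L[ℂ] ℂ :=
  (1 / 2 : ℂ) • (G + ((starL ℂ : ℂ ≃L⋆[ℂ] ℂ) : ℂ →L⋆[ℂ] ℂ).comp
    (G.comp ((starL ℂ : A ≃L⋆[ℂ] A) : A →L⋆[ℂ] A)))

theorem hermitianPart_apply (G : A →L[ℂ] ℂ) (x : A) :
    hermitianPart G x = (1 / 2 : ℂ) * (G x + star (G (star x))) := rfl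

theorem hermitianPart_apply_of_isSelfAdjoint (G : A →L[ℂ] ℂ) {x : A} (hx : IsSelfAdjoint x) :
    hermitianPart G x = (G x).re := by
  rw [hermitianPart_apply, hx.star_eq, Complex.star_def, Complex.add_conj]
  push_cast
  ring

theorem norm_hermitianPart_le (G : A →L[ℂ] ℂ) : ‖hermitianPart G‖ ≤ ‖G‖ := by
  refine ContinuousLinearMap.opNorm_le_bound _ (norm_nonneg G) fun x => ?_
  have hstar : ‖star (G (star x))‖ ≤ ‖G‖ * ‖x‖ := by
    simpa only [norm_star] using G.le_opNorm (star x)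
  calc ‖hermitianPart G x‖ ≤ 1 / 2 * (‖G x‖ + ‖star (G (star x))‖) := by
        rw [hermitianPart_apply, norm_mul]
        gcongr
        · norm_num
        · exact norm_add_le _ _
    _ ≤ ‖G‖ * ‖x‖ := by linarith [G.le_opNorm x]

theorem exists_dominating_positive_functional (hφ : ∀ x y, φ (x * y) = φ x * φ y)
    (hρ : ∀ x, 0 ≤ ρ (star x * x)) :
    ∃ G : A →L[ℂ] ℂ, (∀ a, 0 ≤ G (star a * a)) ∧ ‖G‖ ≤ ‖ρ‖ * ‖φ‖ ^ 2 ∧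
      ∀ a, gnsNormSq ρ (φ a) ≤ ‖φ‖ ^ 2 * gnsNormSq G a := by
  obtain rfl | hφ₀ := eq_or_ne φ 0
  · exact ⟨0, by simp, by simp, by simp [gnsNormSq]⟩
  obtain ⟨G, hGK, hG⟩ := exists_functional_gnsNormSq_map_mul_le hφ hρ
  have hdom := gnsNormSq_map_le_of_forall_mul_le hG
  have hermitian_apply (a : A) : hermitianPart G (star a * a) = gnsNormSq G a :=
    hermitianPart_apply_of_isSelfAdjoint G (.star_mul_self a)
  refine ⟨hermitianPart G, fun a => ?_, (norm_hermitianPart_le G).trans hGK, fun a => ?_⟩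
  · rw [hermitian_apply, Complex.zero_le_real]
    exact nonneg_of_mul_nonneg_right ((gnsNormSq_nonneg hρ (φ a)).trans (hdom a)) (by positivity)
  · rw [gnsNormSq, gnsNormSq, ContinuousLinearMap.coe_coe (hermitianPart G), hermitian_apply,
      Complex.ofReal_re]
    exact hdom a

end BoundedHomomorphism

section TensorProduct

section Comparison

variable {A B C D : Type*} [NonUnitalCStarAlgebra A] [NonUnitalCStarAlgebra B]
  [NonUnitalCStarAlgebra C] [NonUnitalCStarAlgebra D]

@[simp]
theorem tensorFunctional_tmul (ρ₁ : A →L[ℂ] ℂ) (ρ₂ : B →L[ℂ] ℂ) (a : A) (b : B) :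
    tensorFunctional ρ₁ ρ₂ (a ⊗ₜ b) = ρ₁ a * ρ₂ b := rfl

theorem tensorFunctional_star_sum_mul_sum {ι : Type*} [Fintype ι] (ρ₁ : A →L[ℂ] ℂ)
    (ρ₂ : B →L[ℂ] ℂ) (a : ι → A) (b : ι → B) :
    tensorFunctional ρ₁ ρ₂ (star (∑ i, a i ⊗ₜ[ℂ] b i) * ∑ i, a i ⊗ₜ[ℂ] b i) =
      ∑ i, ∑ j, gramForm ρ₁ (a i) (a j) * gramForm ρ₂ (b i) (b j) := by
  simp only [star_sum, Finset.sum_mul_sum, TensorProduct.star_tmul,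
    Algebra.TensorProduct.tmul_mul_tmul, map_sum, tensorFunctional_tmul, gramForm_apply,
    ContinuousLinearMap.coe_coe]

theorem tensorFunctional_star_mul_self_nonneg {ρ₁ : A →L[ℂ] ℂ} {ρ₂ : B →L[ℂ] ℂ}
    (hρ₁ : ∀ x, 0 ≤ ρ₁ (star x * x)) (hρ₂ : ∀ x, 0 ≤ ρ₂ (star x * x)) (X : A ⊗[ℂ] B) :
    0 ≤ tensorFunctional ρ₁ ρ₂ (star X * X) := by
  obtain ⟨n, a, b, rfl⟩ := TensorProduct.exists_sum_tmul_eq X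
  rw [tensorFunctional_star_sum_mul_sum]
  exact sum_sum_mul_nonneg_of_isNonneg ⟨hρ₁⟩ ⟨hρ₂⟩ a b

theorem gnsNormSq_tensorFunctional_map_le {σ₁ : C →L[ℂ] ℂ} {σ₂ : D →L[ℂ] ℂ} {ρ₁ : A →L[ℂ] ℂ}
    {ρ₂ : B →L[ℂ] ℂ} (hσ₁ : ∀ x, 0 ≤ σ₁ (star x * x)) (hσ₂ : ∀ x, 0 ≤ σ₂ (star x * x))
    (hρ₁ : ∀ x, 0 ≤ ρ₁ (star x * x)) (hρ₂ : ∀ x, 0 ≤ ρ₂ (star x * x)) {f : A →ₗ[ℂ] C}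
    {g : B →ₗ[ℂ] D} {K L : ℝ} (hK : 0 ≤ K) (hf : ∀ a, gnsNormSq σ₁ (f a) ≤ K * gnsNormSq ρ₁ a)
    (hg : ∀ b, gnsNormSq σ₂ (g b) ≤ L * gnsNormSq ρ₂ b) (X : A ⊗[ℂ] B) :
    gnsNormSq (tensorFunctional σ₁ σ₂) (TensorProduct.map f g X) ≤
      K * L * gnsNormSq (tensorFunctional ρ₁ ρ₂) X := by
  obtain ⟨n, a, b, rfl⟩ := TensorProduct.exists_sum_tmul_eq X
  simp only [map_sum, TensorProduct.map_tmul]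
  have hle := sum_sum_mul_le_of_isNonneg (isNonneg_smul_gramForm_sub_comp hρ₁ hσ₁ hf)
    (isNonneg_smul_gramForm_sub_comp hρ₂ hσ₂ hg)
    ⟨fun x => mul_nonneg (Complex.zero_le_real.2 hK) (hρ₁ x)⟩ ⟨fun x => hσ₂ (g x)⟩ a b
  simp only [gnsNormSq, tensorFunctional_star_sum_mul_sum]
  rw [← Complex.re_ofReal_mul]
  refine (Complex.le_def.1 hle).1.trans_eq (congrArg Complex.re ?_)
  simp only [LinearMap.smul_apply, smul_eq_mul, Finset.mul_sum]
  push_cast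
  exact Finset.sum_congr rfl fun i _ => Finset.sum_congr rfl fun j _ => by ring

end Comparison

variable {A B : Type*} [NonUnitalCStarAlgebra A] [NonUnitalCStarAlgebra B]
  {ρ₁ : A →L[ℂ] ℂ} {ρ₂ : B →L[ℂ] ℂ}

theorem gnsNormSq_tensorFunctional_tmul (hρ₁ : ∀ x, 0 ≤ ρ₁ (star x * x))
    (hρ₂ : ∀ x, 0 ≤ ρ₂ (star x * x)) (a : A) (b : B) :
    gnsNormSq (tensorFunctional ρ₁ ρ₂) (a ⊗ₜ b) = gnsNormSq ρ₁ a * gnsNormSq ρ₂ b := by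
  rw [gnsNormSq, TensorProduct.star_tmul, Algebra.TensorProduct.tmul_mul_tmul,
    tensorFunctional_tmul, ← ContinuousLinearMap.coe_coe ρ₁, ← ContinuousLinearMap.coe_coe ρ₂,
    ← ofReal_gnsNormSq hρ₁, ← ofReal_gnsNormSq hρ₂, Complex.re_ofReal_mul, Complex.ofReal_re]

theorem gnsNormSq_tensorFunctional_tmul_mul_le (hρ₁ : ∀ x, 0 ≤ ρ₁ (star x * x))
    (hρ₂ : ∀ x, 0 ≤ ρ₂ (star x * x)) (a : A) (b : B) (X : A ⊗[ℂ] B) :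
    gnsNormSq (tensorFunctional ρ₁ ρ₂) (a ⊗ₜ b * X) ≤
      ‖a‖ ^ 2 * ‖b‖ ^ 2 * gnsNormSq (tensorFunctional ρ₁ ρ₂) X := by
  have hmap : a ⊗ₜ[ℂ] b * X = TensorProduct.map (.mulLeft ℂ a) (.mulLeft ℂ b) X := by
    obtain ⟨n, x, y, rfl⟩ := TensorProduct.exists_sum_tmul_eq X
    simp only [Finset.mul_sum, Algebra.TensorProduct.tmul_mul_tmul, map_sum,
      TensorProduct.map_tmul, LinearMap.mulLeft_apply]
  rw [hmap]
  exact gnsNormSq_tensorFunctional_map_le hρ₁ hρ₂ hρ₁ hρ₂ (sq_nonneg _) (gnsNormSq_mul_le hρ₁ a)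
    (gnsNormSq_mul_le hρ₂ b) X

theorem exists_gnsNormSq_tensorFunctional_mul_le (hρ₁ : ∀ x, 0 ≤ ρ₁ (star x * x))
    (hρ₂ : ∀ x, 0 ≤ ρ₂ (star x * x)) (Y : A ⊗[ℂ] B) :
    ∃ C, ∀ X, gnsNormSq (tensorFunctional ρ₁ ρ₂) (Y * X) ≤
      C * gnsNormSq (tensorFunctional ρ₁ ρ₂) X := by
  induction Y with
  | zero => exact ⟨0, fun X => by simp [gnsNormSq]⟩
  | tmul a b =>
    exact ⟨‖a‖ ^ 2 * ‖b‖ ^ 2, gnsNormSq_tensorFunctional_tmul_mul_le hρ₁ hρ₂ a b⟩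
  | add Y Z hY hZ =>
    obtain ⟨C, hC⟩ := hY
    obtain ⟨C', hC'⟩ := hZ
    refine ⟨2 * (C + C'), fun X => ?_⟩
    rw [add_mul]
    linarith [hC X, hC' X,
      gnsNormSq_add_le (tensorFunctional_star_mul_self_nonneg hρ₁ hρ₂) (Y * X) (Z * X)]

variable {p : Seminorm ℂ (A ⊗[ℂ] B)}

theorem IsCStarNorm.isCStarSeminorm (hp : IsCStarNorm p) : IsCStarSeminorm p :=
  ⟨hp.mul_le, hp.star_mul_self⟩

theorem IsCStarNorm.le_of_isCStarSeminorm (hp : IsCStarNorm p)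
    (hmax : ∀ r : Seminorm ℂ (A ⊗[ℂ] B), IsCStarNorm r → r ≤ p) {q : Seminorm ℂ (A ⊗[ℂ] B)}
    (hq : IsCStarSeminorm q) : q ≤ p := by
  have hsup : IsCStarSeminorm (p ⊔ q) := hp.isCStarSeminorm.sup hq
  refine le_sup_right.trans (hmax (p ⊔ q) ⟨fun x hx => ?_, hsup.mul_le, hsup.star_mul_self⟩)
  exact hp.eq_zero_of_apply_eq_zero x
    (le_antisymm ((le_sup_left (b := q) x).trans_eq hx) (apply_nonneg p x))

theorem IsCStarNorm.gnsNormSq_tensorFunctional_mul_le (hp : IsCStarNorm p)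
    (hmax : ∀ r : Seminorm ℂ (A ⊗[ℂ] B), IsCStarNorm r → r ≤ p)
    (hρ₁ : ∀ x, 0 ≤ ρ₁ (star x * x)) (hρ₂ : ∀ x, 0 ≤ ρ₂ (star x * x)) (Y Z : A ⊗[ℂ] B) :
    gnsNormSq (tensorFunctional ρ₁ ρ₂) (Y * Z) ≤
      p Y ^ 2 * gnsNormSq (tensorFunctional ρ₁ ρ₂) Z := by
  have hpos := tensorFunctional_star_mul_self_nonneg hρ₁ hρ₂
  obtain ⟨q, hq, hle⟩ := exists_isCStarSeminorm_gnsNormSq_mul_le hpos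
    (exists_gnsNormSq_tensorFunctional_mul_le hρ₁ hρ₂)
  refine (hle Y Z).trans ?_
  gcongr
  · exact gnsNormSq_nonneg hpos Z
  · exact hp.le_of_isCStarSeminorm hmax hq Y

theorem tendsto_gnsNormSq_tensorFunctional_mul_tmul (ρ₁ : A →L[ℂ] ℂ) (ρ₂ : B →L[ℂ] ℂ)
    {la : Filter A} {lb : Filter B} (hla : la.IsApproximateUnit) (hlb : lb.IsApproximateUnit)
    (Y : A ⊗[ℂ] B) :
    Tendsto (fun e : A × B => gnsNormSq (tensorFunctional ρ₁ ρ₂) (Y * e.1 ⊗ₜ e.2)) (la ×ˢ lb)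
      (𝓝 (gnsNormSq (tensorFunctional ρ₁ ρ₂) Y)) := by
  obtain ⟨n, a, b, rfl⟩ := TensorProduct.exists_sum_tmul_eq Y
  have ha (i : Fin n) : Tendsto (fun e : A × B => a i * e.1) (la ×ˢ lb) (𝓝 (a i)) :=
    (hla.tendsto_mul_left (a i)).comp tendsto_fst
  have hb (i : Fin n) : Tendsto (fun e : A × B => b i * e.2) (la ×ˢ lb) (𝓝 (b i)) :=
    (hlb.tendsto_mul_left (b i)).comp tendsto_snd
  simp only [gnsNormSq, Finset.sum_mul, Algebra.TensorProduct.tmul_mul_tmul,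
    tensorFunctional_star_sum_mul_sum, gramForm_apply, ContinuousLinearMap.coe_coe]
  exact (Complex.continuous_re.tendsto _).comp <| tendsto_finsetSum _ fun i _ =>
    tendsto_finsetSum _ fun j _ =>
      ((ρ₁.continuous.tendsto _).comp ((ha i).star.mul (ha j))).mul
        ((ρ₂.continuous.tendsto _).comp ((hb i).star.mul (hb j)))

theorem IsCStarNorm.gnsNormSq_tensorFunctional_le (hp : IsCStarNorm p)
    (hmax : ∀ r : Seminorm ℂ (A ⊗[ℂ] B), IsCStarNorm r → r ≤ p)
    (hρ₁ : ∀ x, 0 ≤ ρ₁ (star x * x)) (hρ₂ : ∀ x, 0 ≤ ρ₂ (star x * x)) (Y : A ⊗[ℂ] B) :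
    gnsNormSq (tensorFunctional ρ₁ ρ₂) Y ≤ p Y ^ 2 * (‖ρ₁‖ * ‖ρ₂‖) := by
  let _ := CStarAlgebra.spectralOrder A
  let _ := CStarAlgebra.spectralOrderedRing A
  let _ := CStarAlgebra.spectralOrder B
  let _ := CStarAlgebra.spectralOrderedRing B
  have hA := CStarAlgebra.increasingApproximateUnit A
  have hB := CStarAlgebra.increasingApproximateUnit B
  refine le_of_tendsto (tendsto_gnsNormSq_tensorFunctional_mul_tmul ρ₁ ρ₂
    hA.toIsApproximateUnit hB.toIsApproximateUnit Y) ?_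
  filter_upwards [hA.eventually_norm.prod_mk hB.eventually_norm] with ⟨e, f⟩ ⟨he, hf⟩
  refine (hp.gnsNormSq_tensorFunctional_mul_le hmax hρ₁ hρ₂ Y (e ⊗ₜ f)).trans ?_
  rw [gnsNormSq_tensorFunctional_tmul hρ₁ hρ₂]
  gcongr
  · exact gnsNormSq_nonneg hρ₂ f
  · exact gnsNormSq_le_of_norm_le_one ρ₁ he
  · exact gnsNormSq_le_of_norm_le_one ρ₂ hf

end TensorProduct

section MainTheorem

variable {A C B : Type*} [CStarAlgebra A] [NonUnitalCStarAlgebra C] [NonUnitalCStarAlgebra B]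

theorem one_le_norm_of_map_mul {φ : A →L[ℂ] C} (hφ : ∀ x y, φ (x * y) = φ x * φ y)
    (hφ₀ : φ ≠ 0) : 1 ≤ ‖φ‖ := by
  have map_one_ne_zero : φ 1 ≠ 0 := fun h => hφ₀ <| by
    ext x
    rw [← mul_one x, hφ, h, mul_zero, zero_apply]
  have norm_le_sq : ‖φ 1‖ ≤ ‖φ 1‖ * ‖φ 1‖ := by
    conv_lhs => rw [← mul_one (1 : A), hφ]
    exact norm_mul_le _ _
  exact ((le_mul_iff_one_le_right (norm_pos_iff.2 map_one_ne_zero)).1 norm_le_sq).trans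
    (φ.unit_le_opNorm 1 (norm_le_one_of_mem_unitary (one_mem _)))

theorem norm_sq_le_norm_pow_three_of_map_mul {φ : A →L[ℂ] C}
    (hφ : ∀ x y, φ (x * y) = φ x * φ y) : ‖φ‖ ^ 2 ≤ ‖φ‖ ^ 3 := by
  obtain rfl | hφ₀ := eq_or_ne φ 0
  · simp
  · exact pow_le_pow_right₀ (one_le_norm_of_map_mul hφ hφ₀) (by norm_num)

theorem mainTheorem9_general {ρ₁ : C →L[ℂ] ℂ} (hρ₁ : ∀ x, 0 ≤ ρ₁ (star x * x))
    {ρ₂ : B →L[ℂ] ℂ} (hρ₂ : ∀ x, 0 ≤ ρ₂ (star x * x))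
    {φ : A →L[ℂ] C} (hφ : ∀ x y, φ (x * y) = φ x * φ y)
    {p : Seminorm ℂ (A ⊗[ℂ] B)} (hp : IsCStarNorm p)
    (hmax : ∀ r : Seminorm ℂ (A ⊗[ℂ] B), IsCStarNorm r → r ≤ p)
    {X : C ⊗[ℂ] B} {Y : A ⊗[ℂ] B} (hX : X = φ.toLinearMap.rTensor B Y) :
    0 ≤ tensorFunctional ρ₁ ρ₂ (star X * X) ∧
      √(tensorFunctional ρ₁ ρ₂ (star X * X)).re ≤ ‖φ‖ ^ 2 * √(‖ρ₁‖ * ‖ρ₂‖) * p Y := by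
  refine ⟨tensorFunctional_star_mul_self_nonneg hρ₁ hρ₂ X,
    Real.sqrt_le_iff.2 ⟨mul_nonneg (by positivity) (apply_nonneg p Y), ?_⟩⟩
  obtain ⟨G, hG, hGnorm, hGdom⟩ := exists_dominating_positive_functional hφ hρ₁
  calc gnsNormSq (tensorFunctional ρ₁ ρ₂) X
      ≤ ‖φ‖ ^ 2 * 1 * gnsNormSq (tensorFunctional G ρ₂) Y :=
        hX ▸ gnsNormSq_tensorFunctional_map_le hρ₁ hρ₂ hG hρ₂ (sq_nonneg _) hGdom
          (fun b => (one_mul _).ge) Y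
    _ ≤ ‖φ‖ ^ 2 * 1 * (p Y ^ 2 * (‖ρ₁‖ * ‖φ‖ ^ 2 * ‖ρ₂‖)) := by
        gcongr
        exact (hp.gnsNormSq_tensorFunctional_le hmax hG hρ₂ Y).trans (by gcongr)
    _ = (‖φ‖ ^ 2 * √(‖ρ₁‖ * ‖ρ₂‖) * p Y) ^ 2 := by
        rw [mul_pow, mul_pow, Real.sq_sqrt (by positivity)]
        ring

end MainTheorem

theorem mainTheorem9 {B : Type*} [NonUnitalCStarAlgebra B] (hB : IsNuclear B)
    (ρ₁ : BEllTwo →L[ℂ] ℂ) (hρ₁ : IsState ρ₁)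
    (ρ₂ : B →L[ℂ] ℂ) (hρ₂ : IsState ρ₂)
    (φ : CStarFreeInf →L[ℂ] BEllTwo) (hφ : ∀ x y, φ (x * y) = φ x * φ y)
    (p : Seminorm ℂ (CStarFreeInf ⊗[ℂ] B)) (hp : IsCStarNorm p)
    (n : ℕ) (a : Fin n → CStarFreeInf) (b : Fin n → B)
    (X : BEllTwo ⊗[ℂ] B) (hX : X = ∑ i, φ (a i) ⊗ₜ[ℂ] b i) :
    0 ≤ tensorFunctional ρ₁ ρ₂ (star X * X) ∧
      Real.sqrt (tensorFunctional ρ₁ ρ₂ (star X * X)).re ≤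
        ‖φ‖ ^ 3 * p (∑ i, a i ⊗ₜ[ℂ] b i) := by
  have hX_map : X = φ.toLinearMap.rTensor B (∑ i, a i ⊗ₜ[ℂ] b i) := by
    simp only [hX, map_sum, LinearMap.rTensor_tmul, ContinuousLinearMap.coe_coe]
  have hmax (r : Seminorm ℂ (CStarFreeInf ⊗[ℂ] B)) (hr : IsCStarNorm r) : r ≤ p :=
    ((hB CStarFreeInf).unique hr hp).le
  obtain ⟨hpos, hle⟩ := mainTheorem9_general hρ₁.nonneg hρ₂.nonneg hφ hp hmax hX_map
  refine ⟨hpos, hle.trans (mul_le_mul_of_nonneg_right ?_ (apply_nonneg p _))⟩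
  rw [hρ₁.norm_eq_one, hρ₂.norm_eq_one, mul_one, Real.sqrt_one, mul_one]
  exact norm_sq_le_norm_pow_three_of_map_mul hφ
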